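/- **Setting.** Let $(S,\preceq)$ be a finite partially ordered set of sorts with greatest element $\top$ and least element $\bot$, in which every subset has a greatest lower bound. Let $\Sigma$ be an order-sorted signature over $S$: each predicate symbol has a word of argument sorts, and each function symbol (constants included) has a word of argument sorts and a value sort. In addition each sort $s\ne\top,\bot$ is also a unary predicate symbol with argument sort $\top$, called a sort predicate. For each $s\neq\bot$ there are countably infinitely many variables $x{:}s$ (and none of sort $\bot$). The sort $[t]$ of a term $t$ is the sort of the variable $t$, or the value sort of the outermost function symbol of $t$. A term or an atomic formula is well-sorted if each argument $t_i$ (of each subterm, respectively of the atom) satisfies $[t_i]\preceq s_i$, where $s_i$ is the required argument sort. Assume that for every sort $s\ne\bot$ there is a well-sorted ground term $t$ with $[t]\preceq s$. A $\Sigma$-clause is a finite set of well-sorted literals, read as the universal closure of their disjunction; a set of clauses is read as a conjunction. In a $\Sigma$-structure each sort $s$ denotes a set $A_s$, where $A_\top$ is the non-empty universe, $A_\bot=\emptyset$, and $A_s\subseteq A_{s'}$ if $s\preceq s'$; function symbols denote functions, and predicate symbols relations, of the declared sorts; the sort predicate $s$ denotes $A_s$; and variables $x{:}s$ range over $A_s$.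 A set of clauses is $\Sigma$-unsatisfiable if no $\Sigma$-structure satisfies all its clauses, and a clause is valid if every $\Sigma$-structure satisfies it. A $\Sigma$-substitution maps each variable $x{:}s$ to a well-sorted term $t$ with $[t]\preceq s$; unifiers and most general unifiers are taken with respect to $\Sigma$-substitutions. If $C_1,C_2$ are $\Sigma$-clauses with variables standardized apart, $\emptyset\ne m\subseteq C_1$, $\emptyset\neq n\subseteq C_2$, and $\sigma$ is a most general $\Sigma$-unifier of $m\cup\neg n$, then $(C_1\setminus m)\sigma\cup(C_2\setminus n)\sigma$ is a $\Sigma$-resolvent of $C_1$ and $C_2$. If $C=\{L_1,L_2\}\cup D$ and $\sigma$ is a most general $\Sigma$-unifier of $L_1,L_2$, then $(\{L_1\}\cup D)\sigma$ is a factor of $C$. A clause is derivable from a set $\Gamma$ of clauses by $\Sigma$-resolution if it is the last member of a finite sequence of clauses each of which is in $\Gamma$, a $\Sigma$-resolvent of earlier members, or a factor of an earlier member. **Theorem.** Let $A$ and $B$ be finite sets of $\Sigma$-clauses, such that every clause of $A\cup B$ in which a sort predicate occurs is valid (as are, for instance, the sort declarations $\neg s(x)\vee s'(x)$ with $s\preceq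 s'$ and $s(t)$ with $[t]\preceq s$). Suppose that $B$ is not $\Sigma$-unsatisfiable and that $A\cup B$ is $\Sigma$-unsatisfiable. Then there is a finite set $I$ of $\Sigma$-clauses such that (a) every clause of $I$ is derivable from $A$ by $\Sigma$-resolution; (b) $I\cup B$ is $\Sigma$-unsatisfiable; (c) every predicate symbol that occurs in $I$ occurs in both $A$ and $B$. -/

import Mathlib

universe u

namespace OrderSorted

/-- An order-sorted signature over a partially ordered set `S` of sorts with greatest element `⊤`
and least element `⊥`. Every ordinary predicate symbol `p` comes with its word `predArgs p` of
argument sorts; every function symbol `f` with its word `funArgs f` of argument sorts and its value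
sort `funSort f` (constants are the function symbols with the empty word). The sort predicates are
added in `PredSym` below. -/
structure Signature (S : Type u) where
  Pred : Type u
  predArgs : Pred → List S
  Func : Type u
  funArgs : Func → List S
  funSort : Func → S

/-- Variables `x:s`: for each sort `s ≠ ⊥` there are countably many. There is none of sort `⊥`,
since `⊥` denotes the empty set. -/
@[ext]
structure Var (S : Type u) [PartialOrder S] [BoundedOrder S] where
  name : ℕ
  sort : S
  ne_bot : sort ≠ ⊥

section

variable {S : Type u} [PartialOrder S] [BoundedOrder S]

/-- The predicate symbols: the ordinary ones, and one unary sort predicate for each sort other than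
`⊤` and `⊥`. -/
inductive PredSym (Sg : Signature S) : Type u where
  | ordinary (p : Sg.Pred) : PredSym Sg
  | ofSort (s : S) (hbot : s ≠ ⊥) (htop : s ≠ ⊤) : PredSym Sg

/-- The argument sorts of a predicate symbol; a sort predicate has the single argument sort `⊤`. -/
def PredSym.args {Sg : Signature S} : PredSym Sg → List S
  | .ordinary p => Sg.predArgs p
  | .ofSort _ _ _ => [⊤]

/-- Terms, with the right number of arguments but not necessarily well-sorted. -/
inductive Term (Sg : Signature S) : Type u where
  | var (x : Var S) : Term Sg
  | app (f : Sg.Func) (ts : Fin (Sg.funArgs f).length → Term Sg) : Term Sg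

namespace Term

variable {Sg : Signature S}

/-- The sort `[t]` of a term. -/
def sort : Term Sg → S
  | var x => x.sort
  | app f _ => Sg.funSort f

/-- `t` is a `Σ`-term: in every subterm `f(t₁, …, tₙ)`, `[tᵢ] ≤ sᵢ` where `s₁ ⋯ sₙ` are the
argument sorts of `f`. -/
def WellSorted : Term Sg → Prop
  | var _ => True
  | app f ts => ∀ i, (ts i).WellSorted ∧ (ts i).sort ≤ (Sg.funArgs f).get i

/-- The set of variables that occur in a term. -/
def vars : Term Sg → Set (Var S)
  | var x => {x}
  | app _ ts => ⋃ i, (ts i).vars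

/-- The result of replacing each variable `x` of a term by `σ x`. -/
def subst (σ : Var S → Term Sg) : Term Sg → Term Sg
  | var x => σ x
  | app f ts => app f fun i => (ts i).subst σ

end Term

/-- Literals: atomic formulae `p(t₁, …, tₙ)` (`positive = true`) and their negations
(`positive = false`). -/
structure Literal (Sg : Signature S) where
  positive : Bool
  pred : PredSym Sg
  args : Fin pred.args.length → Term Sg

namespace Literal

variable {Sg : Signature S}

def WellSorted (L : Literal Sg) : Prop :=
  ∀ i, (L.args i).WellSorted ∧ (L.args i).sort ≤ L.pred.args.get i

def vars (L : Literal Sg) : Set (Var S) := ⋃ i, (L.args i).vars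

def subst (σ : Var S → Term Sg) (L : Literal Sg) : Literal Sg :=
  ⟨L.positive, L.pred, fun i => (L.args i).subst σ⟩

/-- The complementary literal. -/
def compl (L : Literal Sg) : Literal Sg := ⟨!L.positive, L.pred, L.args⟩

end Literal

/-- `C` is a `Σ`-clause: a finite set of well-sorted literals (read as the universal closure of
their disjunction). The empty set is the empty clause. -/
def IsClause {Sg : Signature S} (C : Set (Literal Sg)) : Prop :=
  C.Finite ∧ ∀ L ∈ C, L.WellSorted

def clauseVars {Sg : Signature S} (C : Set (Literal Sg)) : Set (Var S) := ⋃ L ∈ C, L.vars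

def clauseSubst {Sg : Signature S} (σ : Var S → Term Sg) (C : Set (Literal Sg)) :
    Set (Literal Sg) :=
  Literal.subst σ '' C

/-- The set of predicate symbols (sort predicates included) that occur in a set of clauses. -/
def predSyms {Sg : Signature S} (Γ : Set (Set (Literal Sg))) : Set (PredSym Sg) :=
  {p | ∃ C ∈ Γ, ∃ L ∈ C, L.pred = p}

/-- Some sort predicate occurs in the clause. -/
def MentionsSortPred {Sg : Signature S} (C : Set (Literal Sg)) : Prop :=
  ∃ L ∈ C, ∃ s hbot htop, L.pred = PredSym.ofSort s hbot htop

/-! ### Semantics -/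

/-- `Σ`-structures. The sort `s` denotes the subset `sortSet s` of the non-empty universe; `⊤`
denotes the universe and `⊥` the empty set. A function symbol with argument sorts `s₁ ⋯ sₙ` and
value sort `s` denotes a function from `sortSet s₁ × ⋯ × sortSet sₙ` to `sortSet s`; it is recorded
by an arbitrary extension to all tuples of the universe, whose other values never matter, because
only well-sorted terms are evaluated. -/
structure SigStructure (Sg : Signature S) where
  carrier : Type u
  nonempty : Nonempty carrier
  sortSet : S → Set carrier
  sortSet_mono : ∀ s₁ s₂, s₁ ≤ s₂ → sortSet s₁ ⊆ sortSet s₂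
  sortSet_top : sortSet ⊤ = Set.univ
  sortSet_bot : sortSet ⊥ = ∅
  predSet : (p : Sg.Pred) → Set (Fin (Sg.predArgs p).length → carrier)
  predSet_sorted : ∀ p, ∀ a ∈ predSet p, ∀ i, a i ∈ sortSet ((Sg.predArgs p).get i)
  func : (f : Sg.Func) → (Fin (Sg.funArgs f).length → carrier) → carrier
  func_sorted : ∀ f a, (∀ i, a i ∈ sortSet ((Sg.funArgs f).get i)) →
    func f a ∈ sortSet (Sg.funSort f)

namespace SigStructure

variable {Sg : Signature S}

/-- `α` is a variable assignment: it maps each variable `x:s` into the set denoted by `s`. -/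
def IsAssignment (M : SigStructure Sg) (α : Var S → M.carrier) : Prop :=
  ∀ x, α x ∈ M.sortSet x.sort

/-- The denotation of a term under `α`. -/
def eval (M : SigStructure Sg) (α : Var S → M.carrier) : Term Sg → M.carrier
  | .var x => α x
  | .app f ts => M.func f fun i => M.eval α (ts i)

/-- The relation denoted by a predicate symbol; the sort predicate of `s` denotes `sortSet s`. -/
def predInterp (M : SigStructure Sg) : (p : PredSym Sg) → Set (Fin p.args.length → M.carrier)
  | .ordinary p => M.predSet p
  | .ofSort s _ _ => {a | a (⟨0, Nat.zero_lt_one⟩ : Fin 1) ∈ M.sortSet s}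

/-- `M` satisfies the literal `L` with the assignment `α`. -/
def SatLiteral (M : SigStructure Sg) (α : Var S → M.carrier) (L : Literal Sg) : Prop :=
  (fun i => M.eval α (L.args i)) ∈ M.predInterp L.pred ↔ L.positive = true

/-- `M` satisfies the clause `C`: under every assignment some literal of `C` is satisfied. -/
def SatClause (M : SigStructure Sg) (C : Set (Literal Sg)) : Prop :=
  ∀ α, M.IsAssignment α → ∃ L ∈ C, M.SatLiteral α L

end SigStructure

/-- A clause is valid if every `Σ`-structure satisfies it. -/
def Valid {Sg : Signature S} (C : Set (Literal Sg)) : Prop :=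
  ∀ M : SigStructure Sg, M.SatClause C

/-- A set of clauses (read as a conjunction) is `Σ`-unsatisfiable if no `Σ`-structure satisfies
all its clauses. -/
def Unsatisfiable {Sg : Signature S} (Γ : Set (Set (Literal Sg))) : Prop :=
  ¬ ∃ M : SigStructure Sg, ∀ C ∈ Γ, M.SatClause C

/-! ### `Σ`-resolution -/

/-- `σ` is well-sorted: it maps each variable `x:s` to a `Σ`-term of a sort `≤ s`. -/
def IsSigSubst {Sg : Signature S} (σ : Var S → Term Sg) : Prop :=
  ∀ x, (σ x).WellSorted ∧ (σ x).sort ≤ x.sort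

/-- `θ` is a `Σ`-unifier of the set `F` of literals. -/
def IsSigUnifier {Sg : Signature S} (F : Set (Literal Sg)) (θ : Var S → Term Sg) : Prop :=
  IsSigSubst θ ∧ ∀ L ∈ F, ∀ L' ∈ F, L.subst θ = L'.subst θ

/-- `σ` is a `Σ`-most general unifier of `F`, relative to a set `W` of variables that contains those
of `F`: it is a substitution `{x₁/t₁, …, xⱼ/tⱼ}` where no `xᵢ` occurs in any `tₖ`, it is a
`Σ`-unifier of `F`, and every `Σ`-unifier `θ` of `F` factors on `W` through `σ` and a
`Σ`-substitution. Taking for `W` all the variables of the clauses at hand expresses that variables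
introduced by `σ` are new for these clauses. -/
def IsSigMgu {Sg : Signature S} (W : Set (Var S)) (F : Set (Literal Sg))
    (σ : Var S → Term Sg) : Prop :=
  {x | σ x ≠ Term.var x}.Finite ∧
  (∀ x y, σ x ≠ Term.var x → σ y ≠ Term.var y → x ∉ (σ y).vars) ∧
  IsSigUnifier F σ ∧
  ∀ θ, IsSigUnifier F θ → ∃ τ : Var S → Term Sg, IsSigSubst τ ∧ ∀ x ∈ W, (σ x).subst τ = θ x

/-- `C'` is a variant of `C`: it arises by a sort-preserving renaming of variables. -/
def IsVariant {Sg : Signature S} (C C' : Set (Literal Sg)) : Prop :=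
  ∃ ρ : Equiv.Perm (Var S), (∀ x, (ρ x).sort = x.sort) ∧
    C' = clauseSubst (fun x => Term.var (ρ x)) C

/-- `R` is a `Σ`-resolvent of `C₁` and `C₂`: after standardizing the variables of the two clauses
apart, a non-empty part `m` of the first and a non-empty part `n` of the second are such that
`m ∪ ¬n` has a `Σ`-mgu `σ`, and `R = (C₁ - m)σ ∪ (C₂ - n)σ`. -/
def IsResolvent {Sg : Signature S} (C₁ C₂ R : Set (Literal Sg)) : Prop :=
  ∃ D₁ D₂ : Set (Literal Sg), IsVariant C₁ D₁ ∧ IsVariant C₂ D₂ ∧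
    Disjoint (clauseVars D₁) (clauseVars D₂) ∧
    ∃ m ⊆ D₁, ∃ n ⊆ D₂, m.Nonempty ∧ n.Nonempty ∧
      ∃ σ : Var S → Term Sg,
        IsSigMgu (clauseVars D₁ ∪ clauseVars D₂) (m ∪ Literal.compl '' n) σ ∧
        R = clauseSubst σ (D₁ \ m) ∪ clauseSubst σ (D₂ \ n)

/-- `R` is a factor of `C`: `C = {L₁, L₂} ∪ D`, `σ` is a `Σ`-mgu of `L₁` and `L₂`, and
`R = ({L₁} ∪ D)σ`. -/
def IsFactor {Sg : Signature S} (C R : Set (Literal Sg)) : Prop :=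
  ∃ (L₁ L₂ : Literal Sg) (D : Set (Literal Sg)), C = {L₁, L₂} ∪ D ∧
    ∃ σ : Var S → Term Sg, IsSigMgu (clauseVars C) {L₁, L₂} σ ∧ R = clauseSubst σ ({L₁} ∪ D)

/-- `Γ ⊢ C` by `Σ`-resolution: there is a finite sequence `D 0, …, D k` of clauses with last member
`C`, each of which is in `Γ`, or a `Σ`-resolvent of earlier members, or a factor of an earlier
member. -/
def Derives {Sg : Signature S} (Γ : Set (Set (Literal Sg))) (C : Set (Literal Sg)) : Prop :=
  ∃ (k : ℕ) (D : ℕ → Set (Literal Sg)), D k = C ∧ ∀ i ≤ k,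
    D i ∈ Γ ∨ (∃ j < i, ∃ l < i, IsResolvent (D j) (D l) (D i)) ∨ (∃ j < i, IsFactor (D j) (D i))

/-- `Γ` yields the set `I` of clauses by `Σ`-resolution. -/
def DerivesSet {Sg : Signature S} (Γ I : Set (Set (Literal Sg))) : Prop :=
  ∀ C ∈ I, Derives Γ C

end

end OrderSorted

/-! Atoms, possibly with variables, serve as propositional variables, and a clause stands for the
set of its `Σ`-instances. Valid clauses with sort predicates can be dropped. Let J be the set of
clauses over the common predicate symbols that are derivable from A, and suppose that a valuation
satisfies all instances of J and B. The instances of the clauses derivable from A are closed under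
propositional resolution (`exists_resolvent_of_instances`, which rests on the most general unifiers
of `exists_isSigMgu`). By `exists_valuation_extension` the valuation can therefore be changed on the
atoms whose predicate is foreign to B so as to satisfy all these instances; B is not affected. The
new valuation turns the well-sorted terms, variables included, into a model of A and B, a
contradiction (`not_satInstances_interpolant`).

So no valuation satisfies all instances of J and B. As clauses are finite, each of them defines a
closed set in a product of copies of `Bool`, and compactness leaves a finite part I of J. -/

/-! ### Propositional resolution -/

/-- Completeness of propositional resolution: a set of clauses that is closed under resolution and
does not contain the empty clause is satisfiable. -/
theorem exists_valuation_of_resolution_closed {Λ α : Type*} (atom : Λ → α) (sign : Λ → Bool)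
    (hinj : ∀ K L, atom K = atom L → sign K = sign L → K = L)
    (R : Set (Set Λ)) (hfin : ∀ C ∈ R, C.Finite)
    (hres : ∀ C ∈ R, ∀ D ∈ R, ∀ K ∈ C, ∀ L ∈ D, atom K = atom L → sign K = true →
      sign L = false → (C \ {K}) ∪ (D \ {L}) ∈ R)
    (hempty : ∅ ∉ R) :
    ∃ v : α → Bool, ∀ C ∈ R, ∃ L ∈ C, v (atom L) = sign L := by
  classical
  obtain ⟨_, hwf⟩ := exists_wellFoundedLT α
  have wf : WellFounded ((· < ·) : α → α → Prop) := hwf.wf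
  -- Along a well-order of the atoms, an atom is made true only if a clause forces it: it is the
  -- strictly largest atom there, occurs positively, and all other literals are already false.
  let G : (a : α) → ((b : α) → b < a → Bool) → Bool := fun a rec =>
    decide (∃ D ∈ R, ∃ K ∈ D, atom K = a ∧ sign K = true ∧
      ∀ L ∈ D, L ≠ K → ∃ h : atom L < a, rec (atom L) h ≠ sign L)
  let v : α → Bool := wf.fix G
  have hv : ∀ a, v a = true ↔ ∃ D ∈ R, ∃ K ∈ D, atom K = a ∧ sign K = true ∧
      ∀ L ∈ D, L ≠ K → atom L < a ∧ v (atom L) ≠ sign L := by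
    intro a
    have h : v a = G a (fun b _ => v b) := wf.fix_eq G a
    rw [h]
    simp only [G, decide_eq_true_eq, exists_prop]
  have hmax : ∀ C ∈ R, ∃ L ∈ C, ∀ K ∈ C, atom K ≤ atom L := by
    intro C hC
    have hne : C.Nonempty := by
      rw [Set.nonempty_iff_ne_empty]
      rintro rfl
      exact hempty hC
    exact Set.exists_max_image C atom (hfin C hC) hne
  have key : ∀ a, ∀ C ∈ R, ∀ L ∈ C, atom L = a → (∀ K ∈ C, atom K ≤ a) →
      ∃ L ∈ C, v (atom L) = sign L := by
    intro a
    induction a using wf.induction with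
    | _ a ih =>
      intro C hC L hL hLa hle
      by_contra! hno
      -- A false clause cannot contain both literals upon one atom, so its largest atom occurs in
      -- `L` only.
      have hlt : ∀ K ∈ C, K ≠ L → atom K < a := by
        intro K hK hKL
        refine lt_of_le_of_ne (hle K hK) fun hKa => hKL (hinj K L (hKa.trans hLa.symm) ?_)
        have h1 := hno K hK
        have h2 := hno L hL
        rw [hKa] at h1
        rw [hLa] at h2
        revert h1 h2
        cases v a <;> cases sign K <;> cases sign L <;> simp
      cases hs : sign L with
      | true =>
        refine hno L hL ?_
        rw [hs, hLa, hv]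
        exact ⟨C, hC, L, hL, hLa, hs, fun K hK hKL => ⟨hlt K hK hKL, hno K hK⟩⟩
      | false =>
        have hva : v a = true := by
          have := hno L hL
          rw [hs, hLa] at this
          simpa using this
        obtain ⟨D, hD, K, hK, hKa, hKs, hKD⟩ := (hv a).1 hva
        -- Resolving with the clause that forced `a` gives a false clause with all atoms below `a`,
        -- against the induction hypothesis.
        have hE := hres D hD C hC K hK L hL (hKa.trans hLa.symm) hKs hs
        have hall : ∀ J ∈ (D \ {K}) ∪ (C \ {L}), atom J < a ∧ v (atom J) ≠ sign J := by
          rintro J (⟨hJ, hne⟩ | ⟨hJ, hne⟩)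
          · exact hKD J hJ hne
          · exact ⟨hlt J hJ hne, hno J hJ⟩
        obtain ⟨J, hJ, hJmax⟩ := hmax _ hE
        obtain ⟨J', hJ', hsat⟩ := ih (atom J) (hall J hJ).1 _ hE J hJ rfl hJmax
        exact (hall J' hJ').2 hsat
  refine ⟨v, fun C hC => ?_⟩
  obtain ⟨L, hL, hLm⟩ := hmax C hC
  exact key _ C hC L hL rfl hLm

/-- If a set of clauses is closed under resolution upon the atoms in `N`, then every valuation that
satisfies those of its clauses that are free of `N` can be changed on `N` so as to satisfy all. -/
theorem exists_valuation_extension {Λ α : Type*} (atom : Λ → α) (sign : Λ → Bool)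
    (hinj : ∀ K L, atom K = atom L → sign K = sign L → K = L)
    (R : Set (Set Λ)) (hfin : ∀ C ∈ R, C.Finite) (N : Set α)
    (hres : ∀ C ∈ R, ∀ D ∈ R, ∀ K ∈ C, ∀ L ∈ D, atom K = atom L → atom K ∈ N → sign K = true →
      sign L = false → (C \ {K}) ∪ (D \ {L}) ∈ R)
    (w : α → Bool) (hw : ∀ C ∈ R, (∀ L ∈ C, atom L ∉ N) → ∃ L ∈ C, w (atom L) = sign L) :
    ∃ v : α → Bool, (∀ a ∉ N, v a = w a) ∧ ∀ C ∈ R, ∃ L ∈ C, v (atom L) = sign L := by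
  classical
  -- Only clauses that `w` does not satisfy outside `N` matter. Their parts in `N` are closed under
  -- resolution, and none is empty because `w` satisfies the clauses free of `N`.
  let part : Set Λ → Set Λ := fun C => {L ∈ C | atom L ∈ N}
  obtain ⟨u, hu⟩ := exists_valuation_of_resolution_closed atom sign hinj
    (part '' {C ∈ R | ∀ L ∈ C, atom L ∉ N → w (atom L) ≠ sign L})
    (by
      rintro _ ⟨C, ⟨hC, -⟩, rfl⟩
      exact (hfin C hC).subset fun L hL => hL.1)
    (by
      rintro _ ⟨C, ⟨hC, hCw⟩, rfl⟩ _ ⟨D, ⟨hD, hDw⟩, rfl⟩ K ⟨hK, hKN⟩ L ⟨hL, hLN⟩ hKL hKs hLs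
      refine ⟨_, ⟨hres C hC D hD K hK L hL hKL hKN hKs hLs, ?_⟩, ?_⟩
      · rintro J (⟨hJ, -⟩ | ⟨hJ, -⟩) hJN
        · exact hCw J hJ hJN
        · exact hDw J hJ hJN
      · ext J
        simp only [part, Set.mem_ofPred_eq, Set.mem_union, Set.mem_sdiff, Set.mem_singleton_iff]
        tauto)
    (by
      rintro ⟨C, ⟨hC, hCw⟩, hCe⟩
      have hCN : ∀ L ∈ C, atom L ∉ N := fun L hL hLN => by
        have : L ∈ part C := ⟨hL, hLN⟩
        rw [hCe] at this
        exact this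
      obtain ⟨L, hL, h⟩ := hw C hC hCN
      exact hCw L hL (hCN L hL) h)
  refine ⟨fun a => if a ∈ N then u a else w a, fun a ha => by simp [ha], fun C hC => ?_⟩
  by_cases h : ∀ L ∈ C, atom L ∉ N → w (atom L) ≠ sign L
  · obtain ⟨L, hL, hLu⟩ := hu _ ⟨C, ⟨hC, h⟩, rfl⟩
    exact ⟨L, hL.1, by simpa [hL.2] using hLu⟩
  · push Not at h
    obtain ⟨L, hL, hLN, hLw⟩ := h
    exact ⟨L, hL, by simpa [hLN] using hLw⟩

namespace OrderSorted

section

variable {S : Type u} [PartialOrder S] [BoundedOrder S] {Sg : Signature S}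

/-! ### Terms, literals and substitutions -/

namespace Term

theorem subst_congr {σ τ : Var S → Term Sg} {t : Term Sg} (h : ∀ x ∈ t.vars, σ x = τ x) :
    t.subst σ = t.subst τ := by
  induction t with
  | var x => exact h x rfl
  | app f ts ih =>
    simp only [subst]
    congr 1
    funext i
    exact ih i fun x hx => h x (Set.mem_iUnion.2 ⟨i, hx⟩)

theorem subst_subst (σ τ : Var S → Term Sg) (t : Term Sg) :
    (t.subst σ).subst τ = t.subst fun x => (σ x).subst τ := by
  induction t with
  | var x => rfl
  | app f ts ih =>
    simp only [subst]
    congr 1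
    funext i
    exact ih i

theorem mem_vars_subst {σ : Var S → Term Sg} {t : Term Sg} {x : Var S} :
    x ∈ (t.subst σ).vars ↔ ∃ y ∈ t.vars, x ∈ (σ y).vars := by
  induction t with
  | var y => simp [subst, vars]
  | app f ts ih =>
    simp only [subst, vars, Set.mem_iUnion, ih]
    constructor
    · rintro ⟨i, y, hy, hx⟩
      exact ⟨y, ⟨i, hy⟩, hx⟩
    · rintro ⟨y, ⟨i, hy⟩, hx⟩
      exact ⟨i, y, hy, hx⟩

theorem finite_vars (t : Term Sg) : t.vars.Finite := by
  induction t with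
  | var x => exact Set.finite_singleton x
  | app f ts ih => exact Set.finite_iUnion ih

theorem wellSorted_subst {σ : Var S → Term Sg} {t : Term Sg} (ht : t.WellSorted)
    (h : ∀ x ∈ t.vars, (σ x).WellSorted ∧ (σ x).sort ≤ x.sort) :
    (t.subst σ).WellSorted ∧ (t.subst σ).sort ≤ t.sort := by
  induction t with
  | var x => exact h x rfl
  | app f ts ih =>
    refine ⟨fun i => ?_, le_rfl⟩
    obtain ⟨h1, h2⟩ := ih i (ht i).1 fun x hx => h x (Set.mem_iUnion.2 ⟨i, hx⟩)
    exact ⟨h1, h2.trans (ht i).2⟩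

/-- The number of occurrences of function symbols in a term. -/
def size : Term Sg → ℕ
  | var _ => 0
  | app _ ts => 1 + ∑ i, (ts i).size

theorem size_lt_size_app (f : Sg.Func) (ts : Fin (Sg.funArgs f).length → Term Sg)
    (i : Fin (Sg.funArgs f).length) : (ts i).size < (app f ts).size := by
  have : (ts i).size ≤ ∑ i, (ts i).size :=
    Finset.single_le_sum (f := fun i => (ts i).size) (fun _ _ => Nat.zero_le _) (Finset.mem_univ i)
  simp only [size]
  omega

/-- This plays the role of the occurs check: if a unifier identifies `x` with a compound term, it
gives the variables of that term smaller images than `x`. -/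
theorem size_le_size_subst {θ : Var S → Term Sg} {t : Term Sg} {x : Var S} (hx : x ∈ t.vars) :
    (θ x).size ≤ (t.subst θ).size := by
  induction t with
  | var y =>
    obtain rfl : x = y := hx
    exact le_rfl
  | app f ts ih =>
    obtain ⟨i, hi⟩ := Set.mem_iUnion.1 hx
    exact (ih i hi).trans (size_lt_size_app f (fun i => (ts i).subst θ) i).le

theorem app_subst_injective {f g : Sg.Func} {ts : Fin (Sg.funArgs f).length → Term Sg}
    {us : Fin (Sg.funArgs g).length → Term Sg} {σ : Var S → Term Sg}
    (h : (app f ts).subst σ = (app g us).subst σ) : f = g := by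
  simp only [subst, app.injEq] at h
  exact h.1

end Term

namespace Literal

theorem subst_congr {σ τ : Var S → Term Sg} {L : Literal Sg} (h : ∀ x ∈ L.vars, σ x = τ x) :
    L.subst σ = L.subst τ := by
  simp only [subst, mk.injEq, heq_eq_eq, true_and]
  funext i
  exact Term.subst_congr fun x hx => h x (Set.mem_iUnion.2 ⟨i, hx⟩)

theorem subst_subst (σ τ : Var S → Term Sg) (L : Literal Sg) :
    (L.subst σ).subst τ = L.subst fun x => (σ x).subst τ := by
  simp only [subst, mk.injEq, heq_eq_eq, true_and]
  funext i
  exact Term.subst_subst _ _ _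

theorem finite_vars (L : Literal Sg) : L.vars.Finite :=
  Set.finite_iUnion fun i => (L.args i).finite_vars

theorem WellSorted.subst {σ : Var S → Term Sg} (hσ : IsSigSubst σ) {L : Literal Sg}
    (hL : L.WellSorted) : (L.subst σ).WellSorted := fun i =>
  have h := Term.wellSorted_subst (hL i).1 fun x _ => hσ x
  ⟨h.1, h.2.trans (hL i).2⟩

theorem subst_compl (σ : Var S → Term Sg) (L : Literal Sg) :
    L.compl.subst σ = (L.subst σ).compl := rfl

theorem compl_compl (L : Literal Sg) : L.compl.compl = L := by
  cases L
  simp [compl]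

end Literal

theorem clauseSubst_congr {σ τ : Var S → Term Sg} {C : Set (Literal Sg)}
    (h : ∀ x ∈ clauseVars C, σ x = τ x) : clauseSubst σ C = clauseSubst τ C :=
  Set.image_congr fun _ hL => Literal.subst_congr fun x hx =>
    h x (Set.mem_biUnion hL hx)

theorem clauseSubst_clauseSubst (σ τ : Var S → Term Sg) (C : Set (Literal Sg)) :
    clauseSubst τ (clauseSubst σ C) = clauseSubst (fun x => (σ x).subst τ) C := by
  simp only [clauseSubst, Set.image_image, Literal.subst_subst]

theorem finite_clauseVars {C : Set (Literal Sg)} (hC : C.Finite) : (clauseVars C).Finite :=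
  hC.biUnion fun L _ => L.finite_vars

theorem IsClause.clauseSubst {σ : Var S → Term Sg} (hσ : IsSigSubst σ) {C : Set (Literal Sg)}
    (hC : IsClause C) : IsClause (clauseSubst σ C) :=
  ⟨hC.1.image _, by
    rintro _ ⟨L, hL, rfl⟩
    exact (hC.2 L hL).subst hσ⟩

theorem IsClause.mono {C D : Set (Literal Sg)} (hD : IsClause D) (h : C ⊆ D) : IsClause C :=
  ⟨hD.1.subset h, fun L hL => hD.2 L (h hL)⟩

theorem IsClause.union {C D : Set (Literal Sg)} (hC : IsClause C) (hD : IsClause D) :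
    IsClause (C ∪ D) :=
  ⟨hC.1.union hD.1, by
    rintro L (hL | hL)
    · exact hC.2 L hL
    · exact hD.2 L hL⟩

/-! ### Most general unifiers -/

/-- `t` and `t'` are identified by every `Σ`-unifier of `F`. -/
def Equated (F : Set (Literal Sg)) (t t' : Term Sg) : Prop :=
  ∀ θ, IsSigUnifier F θ → t.subst θ = t'.subst θ

/-- `t` is a well-sorted compound term over the variables `W` that every `Σ`-unifier of `F`
identifies with the variable `x`. -/
def Binds (W : Set (Var S)) (F : Set (Literal Sg)) (x : Var S) (t : Term Sg) : Prop :=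
  t.WellSorted ∧ t.vars ⊆ W ∧ (∃ f ts, t = Term.app f ts) ∧ Equated F (.var x) t

instance Var.countable [Finite S] : Countable (Var S) := by
  have : Function.Injective fun x : Var S => (x.name, x.sort) := by
    rintro ⟨n, s, h⟩ ⟨n', s', h'⟩ he
    simpa using he
  exact this.countable

/-- Names beyond those in `W` are numbered by representatives of the classes of `r`; finitely many
sorts keep the variables countable. -/
theorem exists_fresh_variables [Finite S] {W : Set (Var S)} (hW : W.Finite) (r : Setoid (Var S))
    (g : Var S → S) (hg : ∀ x, g x ≠ ⊥) (hgr : ∀ x y, r x y → g x = g y) :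
    ∃ z : Var S → Var S, (∀ x, z x ∉ W) ∧ (∀ x, (z x).sort = g x) ∧
      ∀ x y, z x = z y ↔ r x y := by
  obtain ⟨e, he⟩ := exists_injective_nat (Var S)
  obtain ⟨N, hN⟩ := (hW.image Var.name).bddAbove
  refine ⟨fun x => ⟨N + 1 + e (Quotient.mk r x).out, g x, hg x⟩, fun x hx => ?_, fun x => rfl,
    fun x y => ⟨fun h => ?_, fun h => ?_⟩⟩
  · have : N + 1 + e (Quotient.mk r x).out ≤ N := hN ⟨_, hx, rfl⟩
    omega
  · have h1 : N + 1 + e (Quotient.mk r x).out = N + 1 + e (Quotient.mk r y).out :=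
      congrArg Var.name h
    have h2 := he (Nat.add_left_cancel h1)
    have h3 := congrArg (Quotient.mk r) h2
    rw [Quotient.out_eq, Quotient.out_eq] at h3
    exact Quotient.exact h3
  · have h1 : Quotient.mk r x = Quotient.mk r y := Quotient.sound h
    simp only [h1, hgr x y h]

/-- A solved form of `F`, given one unifier `θ₀`: variables bound to a compound term are replaced by
such a term, recursively, and the others by the new variable of their class. -/
theorem exists_solved_form {W : Set (Var S)} {F : Set (Literal Sg)} {θ₀ : Var S → Term Sg}
    (hθ₀ : IsSigUnifier F θ₀) (z : Var S → Var S) :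
    ∃ σ : Var S → Term Sg, (∀ x ∉ W, σ x = .var x) ∧
      (∀ x ∈ W, (¬ ∃ t, Binds W F x t) → σ x = .var (z x)) ∧
      ∀ x ∈ W, (∃ t, Binds W F x t) →
        σ x = (Classical.epsilon (h := ⟨.var x⟩) (Binds W F x)).subst σ := by
  classical
  let wf := (measure fun x : Var S => (θ₀ x).size).wf
  let G : (x : Var S) → ((y : Var S) → (θ₀ y).size < (θ₀ x).size → Term Sg) → Term Sg :=
    fun x rec => if x ∈ W then
      if ∃ t, Binds W F x t then
        (Classical.epsilon (h := ⟨.var x⟩) (Binds W F x)).subst fun y =>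
          -- The default `.var y` is never reached, since every variable of a binding term has a
          -- smaller image under `θ₀`.
          if h : (θ₀ y).size < (θ₀ x).size then rec y h else .var y
      else .var (z x) else .var x
  let σ : Var S → Term Sg := wf.fix G
  have hσ : ∀ x, σ x = G x fun y _ => σ y := fun x => wf.fix_eq G x
  refine ⟨σ, fun x hx => ?_, fun x hx h => ?_, fun x hx h => ?_⟩
  · rw [hσ]
    simp only [G, if_neg hx]
  · rw [hσ]
    simp only [G, if_pos hx, if_neg h]
  · rw [hσ]
    simp only [G, if_pos hx, if_pos h]
    obtain ⟨-, -, ⟨f, ts, hf⟩, heq⟩ := Classical.epsilon_spec h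
    refine Term.subst_congr fun y hy => dif_pos ?_
    have h1 := heq θ₀ hθ₀
    simp only [Term.subst] at h1
    rw [h1]
    revert hy
    rw [hf]
    intro hy
    obtain ⟨i, hi⟩ := Set.mem_iUnion.1 hy
    exact (Term.size_le_size_subst hi).trans_lt
      (Term.size_lt_size_app f (fun i => (ts i).subst θ₀) i)

/-- A `Σ`-unifiable set of well-sorted literals has a `Σ`-most general unifier. -/
theorem exists_isSigMgu [Finite S] (hglb : ∀ G : Set S, ∃ s : S, IsGLB G s)
    (hbot : ∀ t : Term Sg, t.WellSorted → t.sort ≠ ⊥)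
    {W : Set (Var S)} (hW : W.Finite) {F : Set (Literal Sg)}
    (hFs : ∀ L ∈ F, L.WellSorted) (hFW : ∀ L ∈ F, L.vars ⊆ W)
    {θ₀ : Var S → Term Sg} (hθ₀ : IsSigUnifier F θ₀) : ∃ σ, IsSigMgu W F σ := by
  classical
  let r : Setoid (Var S) :=
    { r := fun x y => Equated F (.var x) (.var y)
      iseqv := ⟨fun _ _ _ => rfl, fun h θ hθ => (h θ hθ).symm,
        fun h h' θ hθ => (h θ hθ).trans (h' θ hθ)⟩ }
  -- A unifier gives all variables of a class the same image, whose sort lies below all their sorts;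
  -- the greatest lower bound is thus the sort of the most general image.
  choose g hg using fun x : Var S => hglb {s | ∃ y, r x y ∧ y.sort = s}
  have hθg : ∀ θ, IsSigUnifier F θ → ∀ x, (θ x).sort ≤ g x := by
    intro θ hθ x
    refine (hg x).2 ?_
    rintro _ ⟨y, hy, rfl⟩
    have h1 : θ x = θ y := hy θ hθ
    rw [h1]
    exact (hθ.1 y).2
  obtain ⟨z, hzW, hzs, hzr⟩ := exists_fresh_variables hW r g
    -- The bound is not `⊥`, because the well-sorted term `θ₀ x` has a sort below it.
    (fun x h => hbot _ (hθ₀.1 x).1 (le_bot_iff.1 (h ▸ hθg θ₀ hθ₀ x)))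
    (fun x y h => (hg x).unique (by
      convert hg y using 1
      ext s
      exact ⟨fun ⟨w, hw, hs⟩ => ⟨w, r.trans' (r.symm' h) hw, hs⟩,
        fun ⟨w, hw, hs⟩ => ⟨w, r.trans' h hw, hs⟩⟩))
  obtain ⟨σ, hσ₁, hσ₂, hσ₃⟩ := exists_solved_form (W := W) hθ₀ z
  -- induction along the bindings of the solved form
  have ind : ∀ P : Var S → Prop,
      (∀ x ∉ W, P x) → (∀ x ∈ W, σ x = .var (z x) → P x) →
      (∀ x ∈ W, ∀ t, Binds W F x t → σ x = t.subst σ → (∀ y ∈ t.vars, P y) → P x) →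
      ∀ x, P x := by
    intro P h1 h2 h3 x
    induction hn : (θ₀ x).size using Nat.strong_induction_on generalizing x with
    | _ n ih =>
      by_cases hx : x ∈ W
      · by_cases hb : ∃ t, Binds W F x t
        · have ht := Classical.epsilon_spec hb
          refine h3 x hx _ ht (hσ₃ x hx hb) fun y hy => ih _ ?_ y rfl
          obtain ⟨-, -, ⟨f, ts, hf⟩, heq⟩ := ht
          have h4 : θ₀ x = _ := heq θ₀ hθ₀
          rw [← hn, h4]
          rw [hf] at hy ⊢
          obtain ⟨i, hi⟩ := Set.mem_iUnion.1 hy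
          exact (Term.size_le_size_subst hi).trans_lt
            (Term.size_lt_size_app f (fun i => (ts i).subst θ₀) i)
        · exact h2 x hx (hσ₂ x hx hb)
      · exact h1 x hx
  have hsub : IsSigSubst σ := by
    refine ind _ (fun x hx => ?_) (fun x _ h => ?_) fun x _ t ht h hy => ?_
    · rw [hσ₁ x hx]
      exact ⟨trivial, le_rfl⟩
    · rw [h]
      refine ⟨trivial, ?_⟩
      change (z x).sort ≤ x.sort
      rw [hzs]
      exact (hg x).1 ⟨x, r.refl' x, rfl⟩
    · rw [h]
      -- The sort of a compound term depends only on its head symbol, so the sort bound for `θ₀ x`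
      -- carries over.
      obtain ⟨hts, -, ⟨f, ts, rfl⟩, heq⟩ := ht
      refine ⟨(Term.wellSorted_subst hts hy).1, ?_⟩
      have h1 : θ₀ x = _ := heq θ₀ hθ₀
      have h2 := (hθ₀.1 x).2
      rw [h1] at h2
      exact h2
  have hvars : ∀ x ∈ W, ∀ y ∈ (σ x).vars, y ∉ W := by
    refine ind _ (fun x hx h => absurd h hx) (fun x _ h _ y hy => ?_)
      fun x _ t ht h hy _ y hyx => ?_
    · rw [h] at hy
      obtain rfl : y = z x := hy
      exact hzW x
    · rw [h, Term.mem_vars_subst] at hyx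
      obtain ⟨w, hw, hwy⟩ := hyx
      exact hy w hw (ht.2.1 hw) y hwy
  -- Induction on the size of the common image under `θ₀`: it is unchanged when a bound variable is
  -- replaced by its chosen term, and drops on passing to arguments.
  have hunif : ∀ n, ∀ t t' : Term Sg, (t.subst θ₀).size < n → t.WellSorted → t'.WellSorted →
      t.vars ⊆ W → t'.vars ⊆ W → Equated F t t' → t.subst σ = t'.subst σ := by
    intro n
    induction n with
    | zero => intro t t' h; omega
    | succ n ih =>
      have happ : ∀ t t' : Term Sg, (∃ f ts, t = .app f ts) → (∃ f ts, t' = .app f ts) →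
          (t.subst θ₀).size < n + 1 → t.WellSorted → t'.WellSorted →
          t.vars ⊆ W → t'.vars ⊆ W → Equated F t t' → t.subst σ = t'.subst σ := by
        rintro _ _ ⟨f, ts, rfl⟩ ⟨g, us, rfl⟩ hn hts hus htW huW heq
        obtain rfl := Term.app_subst_injective (heq θ₀ hθ₀)
        simp only [Term.subst, Term.app.injEq, heq_eq_eq, true_and]
        funext i
        refine ih _ _ ?_ (hts i).1 (hus i).1 (fun x hx => htW (Set.mem_iUnion.2 ⟨i, hx⟩))
          (fun x hx => huW (Set.mem_iUnion.2 ⟨i, hx⟩)) fun θ hθ => ?_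
        · have := Term.size_lt_size_app f (fun i => (ts i).subst θ₀) i
          simp only [Term.subst] at hn
          omega
        · have := heq θ hθ
          simp only [Term.subst, Term.app.injEq, heq_eq_eq, true_and] at this
          exact congrFun this i
      have hvar : ∀ (x : Var S) (f : Sg.Func) (ts : _), x ∈ W → (θ₀ x).size < n + 1 →
          (Term.app f ts).WellSorted → (Term.app f ts).vars ⊆ W →
          Equated F (.var x) (.app f ts) → σ x = (Term.app f ts).subst σ := by
        intro x f ts hx hn hts htW heq
        have hb : ∃ t, Binds W F x t := ⟨_, hts, htW, ⟨f, ts, rfl⟩, heq⟩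
        rw [hσ₃ x hx hb]
        have hu := Classical.epsilon_spec hb
        refine happ _ _ hu.2.2.1 ⟨f, ts, rfl⟩ ?_ hu.1 hts hu.2.1 htW fun θ hθ => ?_
        · rw [← hu.2.2.2 θ₀ hθ₀]
          exact hn
        · rw [← hu.2.2.2 θ hθ, heq θ hθ]
      intro t t' hn hts hts' htW htW' heq
      cases t with
      | var x =>
        have hx : x ∈ W := htW rfl
        cases t' with
        | var y =>
          have hy : y ∈ W := htW' rfl
          change σ x = σ y
          -- Equated variables have the same binding predicate, so `Classical.epsilon` chooses the
          -- same term for both.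
          have hB : Binds W F x = Binds W F y := by
            funext t
            refine propext (and_congr_right' (and_congr_right' (and_congr_right' ?_)))
            exact ⟨fun h θ hθ => (heq θ hθ).symm.trans (h θ hθ),
              fun h θ hθ => (heq θ hθ).trans (h θ hθ)⟩
          by_cases hb : ∃ t, Binds W F x t
          · rw [hσ₃ x hx hb, hσ₃ y hy (hB ▸ hb)]
            simp only [hB]
          · rw [hσ₂ x hx hb, hσ₂ y hy (hB ▸ hb), (hzr x y).2 heq]
        | app f ts => exact hvar x f ts hx hn hts' htW' heq
      | app f ts =>
        cases t' with
        | var y =>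
          refine (hvar y f ts (htW' rfl) ?_ hts htW fun θ hθ => (heq θ hθ).symm).symm
          have h1 : _ = θ₀ y := heq θ₀ hθ₀
          rw [← h1]
          exact hn
        | app g us => exact happ _ _ ⟨f, ts, rfl⟩ ⟨g, us, rfl⟩ hn hts hts' htW htW' heq
  have hsupp : ∀ x, σ x ≠ .var x → x ∈ W := fun x h => by_contra fun hx => h (hσ₁ x hx)
  refine ⟨σ, hW.subset hsupp, fun x y hx hy h => hvars y (hsupp y hy) x h (hsupp x hx),
    ⟨hsub, ?_⟩, fun θ hθ => ?_⟩
  · rintro ⟨b, p, a⟩ hL ⟨b', p', a'⟩ hL'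
    have h0 := hθ₀.2 _ hL _ hL'
    simp only [Literal.subst, Literal.mk.injEq] at h0
    obtain ⟨rfl, rfl, h0⟩ := h0
    simp only [Literal.subst, Literal.mk.injEq, heq_eq_eq, true_and]
    funext i
    refine hunif _ _ _ (Nat.lt_succ_self _) (hFs _ hL i).1 (hFs _ hL' i).1
      (fun x hx => hFW _ hL (Set.mem_iUnion.2 ⟨i, hx⟩))
      (fun x hx => hFW _ hL' (Set.mem_iUnion.2 ⟨i, hx⟩)) fun θ hθ => ?_
    have := hθ.2 _ hL _ hL'
    simp only [Literal.subst, Literal.mk.injEq, heq_eq_eq, true_and] at this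
    exact congrFun this i
  -- The value of `τ` at `z x` must be `θ x`; this is well defined because `z` identifies only
  -- equated variables.
  · have hτ : ∀ y, ∃ t : Term Sg, t.WellSorted ∧ t.sort ≤ y.sort ∧ ∀ x, z x = y → t = θ x := by
      intro y
      by_cases h : ∃ x, z x = y
      · obtain ⟨x, rfl⟩ := h
        refine ⟨θ x, (hθ.1 x).1, ?_, fun x' hx' => ((hzr x' x).1 hx' θ hθ).symm⟩
        rw [hzs]
        exact hθg θ hθ x
      · exact ⟨.var y, trivial, le_rfl, fun x hx => absurd ⟨x, hx⟩ h⟩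
    choose τ hτ₁ hτ₂ hτ₃ using hτ
    refine ⟨τ, fun x => ⟨hτ₁ x, hτ₂ x⟩, ?_⟩
    refine ind _ (fun x hx h => absurd h hx) (fun x _ h _ => ?_) fun x _ t ht h hy _ => ?_
    · rw [h]
      exact hτ₃ _ x rfl
    · rw [h, Term.subst_subst]
      exact (Term.subst_congr fun y hyt => hy y hyt (ht.2.1 hyt)).trans (ht.2.2.2 θ hθ).symm

end

end OrderSorted

namespace OrderSorted

section

variable {S : Type u} [PartialOrder S] [BoundedOrder S] {Sg : Signature S}

/-! ### Lifting -/

theorem Term.subst_var (t : Term Sg) : t.subst .var = t := by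
  induction t with
  | var x => rfl
  | app f ts ih =>
    simp only [Term.subst]
    congr 1
    funext i
    exact ih i

theorem clauseSubst_var (C : Set (Literal Sg)) : clauseSubst Term.var C = C := by
  have : Literal.subst (Sg := Sg) Term.var = id := by
    funext L
    simp [Literal.subst, Term.subst_var]
  rw [clauseSubst, this, Set.image_id]

/-- With `N` a bound for all names involved, the involution swaps the names `0, …, N` with `N + 1,
…, 2 * N + 1`. -/
theorem exists_renaming_apart {V W : Set (Var S)} (hV : V.Finite) (hW : W.Finite) :
    ∃ ρ : Equiv.Perm (Var S), (∀ x, (ρ x).sort = x.sort) ∧ ∀ x ∈ V, ρ x ∉ W := by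
  obtain ⟨N, hN⟩ := ((hV.union hW).image Var.name).bddAbove
  let f : ℕ → ℕ := fun n => if n ≤ N then n + (N + 1) else if n ≤ 2 * N + 1 then n - (N + 1) else n
  have hf : ∀ n, f (f n) = n := by
    intro n
    simp only [f]
    split_ifs <;> omega
  let F : Var S → Var S := fun x => ⟨f x.name, x.sort, x.ne_bot⟩
  have hF : Function.Involutive F := fun x => by simp [F, hf]
  refine ⟨hF.toPerm F, fun x => rfl, fun x hx hxW => ?_⟩
  have h1 : x.name ≤ N := hN ⟨x, Or.inl hx, rfl⟩
  have h2 : f x.name ≤ N := hN ⟨_, Or.inr hxW, rfl⟩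
  simp only [f, if_pos h1] at h2
  omega

theorem clauseSubst_diff_preimage (θ : Var S → Term Sg) (D : Set (Literal Sg)) (L : Literal Sg) :
    clauseSubst θ (D \ {K ∈ D | K.subst θ = L}) = clauseSubst θ D \ {L} := by
  ext J
  simp only [clauseSubst, Set.mem_image, Set.mem_sdiff, Set.mem_singleton_iff, Set.mem_ofPred_eq]
  constructor
  · rintro ⟨K, ⟨hK, hne⟩, rfl⟩
    exact ⟨⟨K, hK, rfl⟩, fun h => hne ⟨hK, h⟩⟩
  · rintro ⟨⟨K, hK, rfl⟩, hne⟩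
    exact ⟨K, ⟨hK, fun h => hne h.2⟩, rfl⟩

/-- All predicate symbols of the clause `C` belong to `P`. -/
def PredsIn (P : Set (PredSym Sg)) (C : Set (Literal Sg)) : Prop := ∀ L ∈ C, L.pred ∈ P

theorem predsIn_clauseSubst {P : Set (PredSym Sg)} {C : Set (Literal Sg)}
    {σ : Var S → Term Sg} : PredsIn P (clauseSubst σ C) ↔ PredsIn P C := by
  simp only [PredsIn, clauseSubst, Set.forall_mem_image]
  rfl

/-- A resolvent of instances, upon complementary literals, is an instance of a resolvent. -/
theorem exists_resolvent_of_instances [Finite S] (hglb : ∀ G : Set S, ∃ s : S, IsGLB G s)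
    (hbot : ∀ t : Term Sg, t.WellSorted → t.sort ≠ ⊥) {P : Set (PredSym Sg)}
    {D₁ D₂ : Set (Literal Sg)} (h₁ : IsClause D₁) (h₂ : IsClause D₂)
    (hP₁ : PredsIn P D₁) (hP₂ : PredsIn P D₂)
    {θ₁ θ₂ : Var S → Term Sg} (hθ₁ : IsSigSubst θ₁) (hθ₂ : IsSigSubst θ₂) {L : Literal Sg}
    (hL₁ : L ∈ clauseSubst θ₁ D₁) (hL₂ : L.compl ∈ clauseSubst θ₂ D₂) :
    ∃ R, IsResolvent D₁ D₂ R ∧ IsClause R ∧ PredsIn P R ∧ ∃ τ, IsSigSubst τ ∧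
      clauseSubst τ R = (clauseSubst θ₁ D₁ \ {L}) ∪ (clauseSubst θ₂ D₂ \ {L.compl}) := by
  classical
  obtain ⟨ρ, hρs, hρ⟩ := exists_renaming_apart (finite_clauseVars h₂.1) (finite_clauseVars h₁.1)
  set ren : Var S → Term Sg := fun x => .var (ρ x)
  have hren : IsSigSubst ren := fun x => ⟨trivial, (hρs x).le⟩
  set E := clauseSubst ren D₂ with hE
  have hEc : IsClause E := h₂.clauseSubst hren
  have hdisj : Disjoint (clauseVars D₁) (clauseVars E) := by
    rw [Set.disjoint_right]
    intro y hy
    obtain ⟨_, ⟨K, hK, rfl⟩, hyK⟩ := Set.mem_iUnion₂.1 hy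
    obtain ⟨i, hi⟩ := Set.mem_iUnion.1 hyK
    obtain ⟨x, hx, hyx⟩ := Term.mem_vars_subst.1 hi
    obtain rfl : y = ρ x := hyx
    exact hρ x (Set.mem_biUnion hK (Set.mem_iUnion.2 ⟨i, hx⟩))
  -- Disjointness of the variables lets one substitution act as `θ₁` on `D₁` and as `θ₂` on the
  -- renamed `D₂`.
  set θ : Var S → Term Sg := fun x => if x ∈ clauseVars D₁ then θ₁ x else θ₂ (ρ.symm x) with hθdef
  have hθ : IsSigSubst θ := by
    intro x
    simp only [hθdef]
    split_ifs
    · exact hθ₁ x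
    · have := hθ₂ (ρ.symm x)
      rwa [← hρs, Equiv.apply_symm_apply] at this
  have hθD : clauseSubst θ D₁ = clauseSubst θ₁ D₁ := clauseSubst_congr fun x hx => if_pos hx
  have hθE : clauseSubst θ E = clauseSubst θ₂ D₂ := by
    rw [hE, clauseSubst_clauseSubst]
    refine clauseSubst_congr fun x hx => ?_
    simp [ren, Term.subst, hθdef, hρ x hx]
  -- All literals that `θ` sends to the resolved literal are taken at once, so no factoring step is
  -- needed.
  set m := {K ∈ D₁ | K.subst θ = L}
  set n := {K ∈ E | K.subst θ = L.compl}
  have hm : m.Nonempty := by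
    rw [← hθD] at hL₁
    obtain ⟨K, hK, h⟩ := hL₁
    exact ⟨K, hK, h⟩
  have hn : n.Nonempty := by
    rw [← hθE] at hL₂
    obtain ⟨K, hK, h⟩ := hL₂
    exact ⟨K, hK, h⟩
  set W := clauseVars D₁ ∪ clauseVars E
  have hunif : ∀ K ∈ m ∪ Literal.compl '' n, K.subst θ = L := by
    rintro _ (hK | ⟨K, hK, rfl⟩)
    · exact hK.2
    · rw [Literal.subst_compl, hK.2, Literal.compl_compl]
  obtain ⟨σ, hσ⟩ := exists_isSigMgu (W := W) (F := m ∪ Literal.compl '' n) hglb hbot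
    ((finite_clauseVars h₁.1).union (finite_clauseVars hEc.1))
    (by
      rintro _ (hK | ⟨K, hK, rfl⟩)
      · exact h₁.2 _ hK.1
      · exact hEc.2 K hK.1)
    (by
      rintro _ (hK | ⟨K, hK, rfl⟩)
      · exact fun x hx => Or.inl (Set.mem_biUnion hK.1 hx)
      · exact fun x hx => Or.inr (Set.mem_biUnion hK.1 hx))
    (θ₀ := θ) ⟨hθ, fun K hK K' hK' => (hunif K hK).trans (hunif K' hK').symm⟩
  obtain ⟨τ, hτ, hστ⟩ := hσ.2.2.2 θ ⟨hθ, fun K hK K' hK' => (hunif K hK).trans (hunif K' hK').symm⟩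
  have hσs := hσ.2.2.1.1
  have hvars : ∀ {C D : Set (Literal Sg)}, C ⊆ D → clauseVars C ⊆ clauseVars D :=
    fun h => Set.biUnion_subset_biUnion_left h
  refine ⟨_, ⟨D₁, E, ⟨Equiv.refl _, fun _ => rfl, (clauseSubst_var D₁).symm⟩, ⟨ρ, hρs, hE⟩, hdisj,
    m, Set.sep_subset _ _, n, Set.sep_subset _ _, hm, hn, σ, hσ, rfl⟩,
    ((h₁.mono Set.sdiff_subset).clauseSubst hσs).union
      ((hEc.mono Set.sdiff_subset).clauseSubst hσs), ?_, τ, hτ, ?_⟩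
  · have hPE : PredsIn P E := predsIn_clauseSubst.2 hP₂
    rintro K (hK | hK)
    · exact predsIn_clauseSubst.2 (fun J hJ => hP₁ J hJ.1) K hK
    · exact predsIn_clauseSubst.2 (fun J hJ => hPE J hJ.1) K hK
  · have h1 : clauseSubst τ (clauseSubst σ (D₁ \ m)) = clauseSubst θ (D₁ \ m) := by
      rw [clauseSubst_clauseSubst]
      exact clauseSubst_congr fun x hx => hστ x (Or.inl (hvars Set.sdiff_subset hx))
    have h2 : clauseSubst τ (clauseSubst σ (E \ n)) = clauseSubst θ (E \ n) := by
      rw [clauseSubst_clauseSubst]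
      exact clauseSubst_congr fun x hx => hστ x (Or.inr (hvars Set.sdiff_subset hx))
    rw [← hθD, ← hθE, ← clauseSubst_diff_preimage θ D₁, ← clauseSubst_diff_preimage θ E, ← h1, ← h2]
    exact Set.image_union _ _ _

/-! ### Derivations -/

theorem Derives.of_mem {Γ : Set (Set (Literal Sg))} {C : Set (Literal Sg)} (h : C ∈ Γ) :
    Derives Γ C := ⟨0, fun _ => C, rfl, fun _ _ => Or.inl h⟩

theorem Derives.resolvent {Γ : Set (Set (Literal Sg))} {C₁ C₂ R : Set (Literal Sg)}
    (h₁ : Derives Γ C₁) (h₂ : Derives Γ C₂) (h : IsResolvent C₁ C₂ R) : Derives Γ R := by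
  obtain ⟨k, D, rfl, hD⟩ := h₁
  obtain ⟨l, E, rfl, hE⟩ := h₂
  -- Concatenation: `D` fills `0, …, k`, `E` fills `k + 1, …, k + 1 + l`, and `R` comes at `k + l +
  -- 2`.
  let G : ℕ → Set (Literal Sg) := fun i =>
    if i ≤ k then D i else if i ≤ k + 1 + l then E (i - (k + 1)) else R
  have hGD : ∀ i ≤ k, G i = D i := fun i hi => if_pos hi
  have hGE : ∀ i ≤ l, G (k + 1 + i) = E i := fun i hi => by
    simp only [G]
    rw [if_neg (by omega), if_pos (by omega), Nat.add_sub_cancel_left]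
  have hGR : G (k + l + 2) = R := by
    simp only [G]
    rw [if_neg (by omega), if_neg (by omega)]
  refine ⟨k + l + 2, G, hGR, fun i hi => ?_⟩
  rcases Nat.lt_or_ge k i with hk | hk
  · rcases Nat.lt_or_ge (k + 1 + l) i with hl | hl
    · obtain rfl : i = k + l + 2 := by omega
      refine Or.inr (Or.inl ⟨k, by omega, k + 1 + l, by omega, ?_⟩)
      rw [hGD k le_rfl, hGE l le_rfl, hGR]
      exact h
    · obtain ⟨j, rfl⟩ := Nat.exists_eq_add_of_le (show k + 1 ≤ i from hk)
      rw [hGE j (by omega)]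
      rcases hE j (by omega) with h' | ⟨a, ha, b, hb, h'⟩ | ⟨a, ha, h'⟩
      · exact Or.inl h'
      · refine Or.inr (Or.inl ⟨k + 1 + a, by omega, k + 1 + b, by omega, ?_⟩)
        rwa [hGE a (by omega), hGE b (by omega)]
      · refine Or.inr (Or.inr ⟨k + 1 + a, by omega, ?_⟩)
        rwa [hGE a (by omega)]
  · rw [hGD i hk]
    rcases hD i hk with h' | ⟨a, ha, b, hb, h'⟩ | ⟨a, ha, h'⟩
    · exact Or.inl h'
    · refine Or.inr (Or.inl ⟨a, ha, b, hb, ?_⟩)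
      rwa [hGD a (by omega), hGD b (by omega)]
    · refine Or.inr (Or.inr ⟨a, ha, ?_⟩)
      rwa [hGD a (by omega)]

theorem Derives.mono {Γ Δ : Set (Set (Literal Sg))} (h : Γ ⊆ Δ) {C : Set (Literal Sg)} :
    Derives Γ C → Derives Δ C := fun ⟨k, D, hk, hD⟩ =>
  ⟨k, D, hk, fun i hi => (hD i hi).imp_left fun h' => h h'⟩

/-! ### Propositional valuations of atoms -/

/-- Well-formed atomic formulae, over terms with variables. -/
abbrev Atom (Sg : Signature S) : Type u := (p : PredSym Sg) × (Fin p.args.length → Term Sg)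

/-- The atom of a literal. -/
def Literal.atom (L : Literal Sg) : Atom Sg := ⟨L.pred, L.args⟩

theorem Literal.eq_of_atom_eq (K L : Literal Sg) (h : K.atom = L.atom)
    (h' : K.positive = L.positive) : K = L := by
  cases K
  cases L
  simp only [atom, Sigma.mk.injEq] at h
  simp only [mk.injEq]
  exact ⟨h', h⟩

/-- The valuation `v` satisfies all `Σ`-instances of the clause `C`. -/
def SatInstances (v : Atom Sg → Bool) (C : Set (Literal Sg)) : Prop :=
  ∀ θ, IsSigSubst θ → ∃ L ∈ clauseSubst θ C, v L.atom = L.positive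

/-- Each instance, being finite, imposes a finite union of closed conditions on single coordinates.
-/
theorem isClosed_satInstances {C : Set (Literal Sg)} (hC : C.Finite) :
    IsClosed {v : Atom Sg → Bool | SatInstances v C} := by
  have : {v : Atom Sg → Bool | SatInstances v C} = ⋂ (θ : Var S → Term Sg) (_ : IsSigSubst θ),
      ⋃ L ∈ clauseSubst θ C, {v | v L.atom = L.positive} := by
    ext v
    simp [SatInstances]
  rw [this]
  exact isClosed_iInter fun θ => isClosed_iInter fun _ => (hC.image _).isClosed_biUnion fun L _ =>
    isClosed_eq (continuous_apply _) continuous_const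

/-! ### Passage between structures and valuations -/

namespace SigStructure

variable (M : SigStructure Sg)

theorem eval_subst (α : Var S → M.carrier) (σ : Var S → Term Sg) (t : Term Sg) :
    M.eval α (t.subst σ) = M.eval (fun x => M.eval α (σ x)) t := by
  induction t with
  | var x => rfl
  | app f ts ih => simp only [Term.subst, eval, ih]

theorem eval_mem {t : Term Sg} (ht : t.WellSorted) {α : Var S → M.carrier}
    (hα : ∀ x ∈ t.vars, α x ∈ M.sortSet x.sort) : M.eval α t ∈ M.sortSet t.sort := by
  induction t with
  | var x => exact hα x rfl
  | app f ts ih =>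
    exact M.func_sorted f _ fun i => M.sortSet_mono _ _ (ht i).2
      (ih i (ht i).1 fun x hx => hα x (Set.mem_iUnion.2 ⟨i, hx⟩))

theorem exists_isAssignment
    (hground : ∀ s : S, s ≠ ⊥ → ∃ t : Term Sg, t.WellSorted ∧ t.vars = ∅ ∧ t.sort ≤ s) :
    ∃ α, M.IsAssignment α := by
  have : ∀ x : Var S, ∃ a, a ∈ M.sortSet x.sort := fun x => by
    obtain ⟨t, ht, hv, hs⟩ := hground x.sort x.ne_bot
    obtain ⟨a⟩ := M.nonempty
    exact ⟨_, M.sortSet_mono _ _ hs (M.eval_mem (α := fun _ => a) ht (by simp [hv]))⟩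
  choose α hα using this
  exact ⟨α, hα⟩

/-- The valuation of atoms induced by a structure and an assignment. -/
noncomputable def valuation (α : Var S → M.carrier) (a : Atom Sg) : Bool :=
  open Classical in decide ((fun i => M.eval α (a.2 i)) ∈ M.predInterp a.1)

/-- Composing a `Σ`-substitution with an assignment yields an assignment, so a true clause holds in
all its instances, even with variables frozen by `α`. -/
theorem satInstances_valuation {α : Var S → M.carrier} (hα : M.IsAssignment α)
    {C : Set (Literal Sg)} (hC : M.SatClause C) : SatInstances (M.valuation α) C := by
  classical
  intro θ hθ
  obtain ⟨L, hL, h⟩ := hC (fun x => M.eval α (θ x)) fun x =>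
    M.sortSet_mono _ _ (hθ x).2 (M.eval_mem (hθ x).1 fun y _ => hα y)
  refine ⟨_, ⟨L, hL, rfl⟩, ?_⟩
  simp only [SatLiteral, ← eval_subst] at h
  rw [Bool.eq_iff_iff]
  exact decide_eq_true_iff.trans h

end SigStructure

/-- The structure of well-sorted terms in which an ordinary predicate symbol holds as `v` says. -/
noncomputable def termStructure (hbot : ∀ t : Term Sg, t.WellSorted → t.sort ≠ ⊥)
    (t₀ : {t : Term Sg // t.WellSorted}) (v : Atom Sg → Bool) : SigStructure Sg where
  carrier := {t : Term Sg // t.WellSorted}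
  nonempty := ⟨t₀⟩
  sortSet s := {t | t.1.sort ≤ s}
  sortSet_mono _ _ h _ ht := le_trans ht h
  sortSet_top := Set.eq_univ_of_forall fun _ => le_top
  sortSet_bot := Set.eq_empty_of_forall_notMem fun t ht => hbot t.1 t.2 (le_bot_iff.1 ht)
  predSet p := {a | (∀ i, (a i).1.sort ≤ (Sg.predArgs p).get i) ∧
    v ⟨.ordinary p, fun i => (a i).1⟩ = true}
  predSet_sorted _ _ ha i := ha.1 i
  func f a := open Classical in
    -- The value `t₀` on ill-sorted tuples is irrelevant.
    if h : (Term.app f fun i => (a i).1).WellSorted then ⟨_, h⟩ else t₀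
  func_sorted f a ha := by
    have h : (Term.app f fun i => (a i).1).WellSorted := fun i => ⟨(a i).2, ha i⟩
    rw [dif_pos h]
    exact le_refl (Sg.funSort f)

theorem eval_termStructure (hbot : ∀ t : Term Sg, t.WellSorted → t.sort ≠ ⊥)
    (t₀ : {t : Term Sg // t.WellSorted}) (v : Atom Sg → Bool)
    {α : Var S → (termStructure hbot t₀ v).carrier} (hα : (termStructure hbot t₀ v).IsAssignment α)
    {t : Term Sg} (ht : t.WellSorted) :
    ((termStructure hbot t₀ v).eval α t).1 = t.subst fun x => (α x).1 := by
  induction t with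
  | var x => rfl
  | app f ts ih =>
    have h1 : (fun i => ((termStructure hbot t₀ v).eval α (ts i)).1) =
        fun i => (ts i).subst fun x => (α x).1 := funext fun i => ih i (ht i).1
    have h2 : (Term.app f fun i => ((termStructure hbot t₀ v).eval α (ts i)).1).WellSorted := by
      rw [h1]
      exact (Term.wellSorted_subst (t := .app f ts) ht fun x _ => ⟨(α x).2, hα x⟩).1
    simp only [SigStructure.eval]
    refine (congrArg Subtype.val (dif_pos h2)).trans ?_
    simp only [Term.subst]
    rw [h1]

/-- Assignments into the term structure are exactly `Σ`-substitutions. Sort predicates are excluded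
because the sorts fix their meaning, whatever `v` says. -/
theorem satClause_termStructure (hbot : ∀ t : Term Sg, t.WellSorted → t.sort ≠ ⊥)
    (t₀ : {t : Term Sg // t.WellSorted}) {v : Atom Sg → Bool} {C : Set (Literal Sg)}
    (hC : IsClause C) (hs : ¬ MentionsSortPred C) (hv : SatInstances v C) :
    (termStructure hbot t₀ v).SatClause C := by
  intro α hα
  have hθ : IsSigSubst fun x => (α x).1 := fun x => ⟨(α x).2, hα x⟩
  obtain ⟨_, ⟨L, hL, rfl⟩, h⟩ := hv _ hθ
  refine ⟨L, hL, ?_⟩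
  have hw := hC.2 L hL
  obtain ⟨b, p, a⟩ := L
  cases p with
  | ofSort s h1 h2 => exact absurd ⟨_, hL, s, h1, h2, rfl⟩ hs
  | ordinary p =>
    have he : (fun i => ((termStructure hbot t₀ v).eval α (a i)).1) =
        fun i => (a i).subst fun x => (α x).1 :=
      funext fun i => eval_termStructure hbot t₀ v hα (hw i).1
    rw [Bool.eq_iff_iff] at h
    refine Iff.trans ?_ h
    change (_ ∧ v ⟨.ordinary p, fun i => ((termStructure hbot t₀ v).eval α (a i)).1⟩ = true) ↔ _
    rw [he]
    refine and_iff_right fun i => ?_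
    exact (congrArg Term.sort (congrFun he i)).trans_le (hw.subst hθ i).2

/-! ### Interpolation -/

/-- The interpolation theorem for clauses without sort predicates, before it is cut down to a finite
set: a valuation satisfies no instances of both `B` and the clauses over the common predicate
symbols that are derivable from `A`. -/
theorem not_satInstances_interpolant [Finite S] (hglb : ∀ G : Set S, ∃ s : S, IsGLB G s)
    (hbot : ∀ t : Term Sg, t.WellSorted → t.sort ≠ ⊥) (t₀ : {t : Term Sg // t.WellSorted})
    {A B : Set (Set (Literal Sg))} (hA : ∀ C ∈ A, IsClause C ∧ ¬ MentionsSortPred C)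
    (hB : ∀ C ∈ B, IsClause C ∧ ¬ MentionsSortPred C) (hAB : Unsatisfiable (A ∪ B))
    (v : Atom Sg → Bool)
    (hJ : ∀ C, Derives A C → IsClause C → PredsIn (predSyms A) C → PredsIn (predSyms B) C →
      SatInstances v C) :
    ¬ ∀ C ∈ B, SatInstances v C := by
  intro hvB
  obtain ⟨w, hwv, hw⟩ := exists_valuation_extension Literal.atom Literal.positive
    Literal.eq_of_atom_eq
    {C | ∃ D, Derives A D ∧ IsClause D ∧ PredsIn (predSyms A) D ∧
      ∃ θ, IsSigSubst θ ∧ clauseSubst θ D = C}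
    (by
      rintro _ ⟨D, -, hD, -, θ, -, rfl⟩
      exact hD.1.image _)
    {a | a.1 ∉ predSyms B}
    (by
      rintro _ ⟨D, hAD, hD, hDP, θ, hθ, rfl⟩ _ ⟨E, hAE, hE, hEP, η, hη, rfl⟩ K hK L hL hKL - hKs hLs
      obtain rfl : L = K.compl := Literal.eq_of_atom_eq _ _ hKL.symm
        (by simp [Literal.compl, hKs, hLs])
      obtain ⟨R, hR, hRc, hRP, τ, hτ, h⟩ :=
        exists_resolvent_of_instances hglb hbot hD hE hDP hEP hθ hη hK hL
      exact ⟨R, hAD.resolvent hAE hR, hRc, hRP, τ, hτ, h⟩)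
    v
    (by
      rintro _ ⟨D, hAD, hD, hDP, θ, hθ, rfl⟩ hN
      -- Substitution keeps predicate symbols, so an instance free of foreign atoms comes from a
      -- clause over the common symbols.
      exact hJ D hAD hD hDP (predsIn_clauseSubst.1 fun L hL => not_not.1 (hN L hL)) θ hθ)
  refine hAB ⟨termStructure hbot t₀ w, ?_⟩
  rintro C (hC | hC)
  · exact satClause_termStructure hbot t₀ (hA C hC).1 (hA C hC).2 fun θ hθ =>
      hw _ ⟨C, .of_mem hC, (hA C hC).1, fun L hL => ⟨C, hC, L, hL, rfl⟩, θ, hθ, rfl⟩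
  · refine satClause_termStructure hbot t₀ (hB C hC).1 (hB C hC).2 fun θ hθ => ?_
    obtain ⟨_, ⟨L, hL, rfl⟩, h⟩ := hvB C hC θ hθ
    refine ⟨_, ⟨L, hL, rfl⟩, ?_⟩
    rw [hwv, h]
    exact not_not.2 ⟨C, hC, L, hL, rfl⟩

end

end OrderSorted

theorem mainTheorem2 {S : Type u} [PartialOrder S] [BoundedOrder S] [Finite S]
    (hglb : ∀ G : Set S, ∃ s : S, IsGLB G s)
    (Sg : OrderSorted.Signature S)
    (hground : ∀ s : S, s ≠ ⊥ →
      ∃ t : OrderSorted.Term Sg, t.WellSorted ∧ t.vars = ∅ ∧ t.sort ≤ s)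
    (A B : Set (Set (OrderSorted.Literal Sg)))
    (hA : A.Finite) (hAc : ∀ C ∈ A, OrderSorted.IsClause C)
    (hB : B.Finite) (hBc : ∀ C ∈ B, OrderSorted.IsClause C)
    (hsort : ∀ C ∈ A ∪ B, OrderSorted.MentionsSortPred C → OrderSorted.Valid C)
    (hBsat : ¬ OrderSorted.Unsatisfiable B)
    (hAB : OrderSorted.Unsatisfiable (A ∪ B)) :
    ∃ I : Set (Set (OrderSorted.Literal Sg)),
      I.Finite ∧ (∀ C ∈ I, OrderSorted.IsClause C) ∧
      OrderSorted.DerivesSet A I ∧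
      OrderSorted.Unsatisfiable (I ∪ B) ∧
      ∀ p ∈ OrderSorted.predSyms I,
        p ∈ OrderSorted.predSyms A ∧ p ∈ OrderSorted.predSyms B := by
  open OrderSorted in
  classical
  -- Any structure will do here: its existence shows that no well-sorted term has sort `⊥` and that
  -- `⊤ ≠ ⊥`.
  obtain ⟨M, -⟩ := not_not.1 hBsat
  obtain ⟨α, hα⟩ := M.exists_isAssignment hground
  have hbot : ∀ t : Term Sg, t.WellSorted → t.sort ≠ ⊥ := fun t ht h => by
    have := M.eval_mem ht fun x _ => hα x
    rw [h, M.sortSet_bot] at this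
    exact this
  have htop : (⊤ : S) ≠ ⊥ := fun h => by
    obtain ⟨a⟩ := M.nonempty
    have : a ∈ M.sortSet ⊤ := M.sortSet_top ▸ Set.mem_univ a
    rw [h, M.sortSet_bot] at this
    exact this
  obtain ⟨t₀, ht₀, -⟩ := hground ⊤ htop
  let A' := {C ∈ A | ¬ MentionsSortPred C}
  let B' := {C ∈ B | ¬ MentionsSortPred C}
  have hAB' : Unsatisfiable (A' ∪ B') := by
    rintro ⟨M, hM⟩
    refine hAB ⟨M, fun C hC => ?_⟩
    by_cases hs : MentionsSortPred C
    · exact hsort C hC hs M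
    · exact hM C (hC.imp (fun h => ⟨h, hs⟩) fun h => ⟨h, hs⟩)
  let J := {C | Derives A' C ∧ IsClause C ∧ PredsIn (predSyms A') C ∧ PredsIn (predSyms B') C}
  let K : ↥(J ∪ B') → Set (Atom Sg → Bool) := fun C => {v | SatInstances v C.1}
  have hK : ∀ C, IsClosed (K C) := fun C => isClosed_satInstances
    (C.2.elim (fun h => h.2.1.1) fun h => (hBc _ h.1).1)
  have hempty : (Set.univ ∩ ⋂ C, K C) = ∅ := by
    refine Set.eq_empty_of_forall_notMem fun v hv => ?_
    have hv' : ∀ C ∈ J ∪ B', SatInstances v C := fun C hC => Set.mem_iInter.1 hv.2 ⟨C, hC⟩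
    exact not_satInstances_interpolant hglb hbot ⟨t₀, ht₀⟩ (fun C hC => ⟨hAc C hC.1, hC.2⟩)
      (fun C hC => ⟨hBc C hC.1, hC.2⟩) hAB' v
      (fun C h1 h2 h3 h4 => hv' C (Or.inl ⟨h1, h2, h3, h4⟩)) fun C hC => hv' C (Or.inr hC)
  obtain ⟨u, hu⟩ := isCompact_univ.elim_finite_subfamily_closed K hK hempty
  -- Of the finite subfamily only the members of `J` are kept; the others already belong to `B`.
  refine ⟨Subtype.val '' (u : Set ↥(J ∪ B')) ∩ J, (u.finite_toSet.image _).inter_of_left _,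
    fun C hC => hC.2.2.1, fun C hC => hC.2.1.mono fun _ h => h.1, ?_, ?_⟩
  · rintro ⟨M, hM⟩
    obtain ⟨α, hα⟩ := M.exists_isAssignment hground
    refine (Set.eq_empty_iff_forall_notMem.1 hu) (M.valuation α) ⟨trivial, ?_⟩
    refine Set.mem_iInter₂.2 fun C hC => M.satInstances_valuation hα (hM _ ?_)
    exact C.2.imp (fun h => ⟨⟨C, hC, rfl⟩, h⟩) fun h => h.1
  · rintro p ⟨C, hC, L, hL, rfl⟩
    obtain ⟨D, hD, h⟩ := hC.2.2.2.1 L hL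
    obtain ⟨E, hE, h'⟩ := hC.2.2.2.2 L hL
    exact ⟨⟨D, hD.1, h⟩, ⟨E, hE.1, h'⟩⟩
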